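/- Let $\mathcal{A}=(a_{ijkl})_{i,j,k,l\in\{1,2\}}$ be a real symmetric tensor of order $4$ and dimension $2$ (its entries are invariant under all permutations of the four indices), and suppose $a_{1111}\neq 0$ and $a_{2222}\neq 0$. Call $\mathcal{A}$ copositive if $$\mathcal{A}x^4:=\sum_{i,j,k,l=1}^{2}a_{ijkl}x_ix_jx_kx_l\ \ge\ 0\qquad\text{for all }x=(x_1,x_2)\in\mathbb{R}^2\text{ with }x_1\ge 0,\ x_2\ge 0.$$ Put $$I=a_{1111}a_{2222}-4a_{1112}a_{1222}+3a_{1122}^{2},$$ $$J=a_{1111}a_{1122}a_{2222}+2a_{1112}a_{1122}a_{1222}-a_{1122}^{3}-a_{1111}a_{1222}^{2}-a_{1112}^{2}a_{2222}.$$ Then $\mathcal{A}$ is copositive if and only if $a_{1111}>0$, $a_{2222}>0$ and at least one of the following three conditions holds: (1) $I^3-27J^2\le 0$ and $a_{1222}\sqrt{a_{1111}}+a_{1112}\sqrt{a_{2222}}>0$; (2) $a_{1222}\ge 0$, $a_{1112}\ge 0$ and $3a_{1122}+\sqrt{a_{1111}a_{2222}}\ge 0$; (3) $I^3-27J^2\ge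 0$, $$\left|a_{1112}\sqrt{a_{2222}}-a_{1222}\sqrt{a_{1111}}\right|\le\sqrt{6a_{1111}a_{1122}a_{2222}+2a_{1111}a_{2222}\sqrt{a_{1111}a_{2222}}},$$ and either (i) $-\sqrt{a_{1111}a_{2222}}\le 3a_{1122}\le 3\sqrt{a_{1111}a_{2222}}$, or (ii) $a_{1122}>\sqrt{a_{1111}a_{2222}}$ and $$a_{1112}\sqrt{a_{2222}}+a_{1222}\sqrt{a_{1111}}\ge-\sqrt{6a_{1111}a_{1122}a_{2222}-2a_{1111}a_{2222}\sqrt{a_{1111}a_{2222}}}.$$ -/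

import Mathlib

/-- A real tensor of order `m` and dimension `n`: an entry `A i` for each
multi-index `i = (i₁, …, iₘ)`. Indices start at `0`, so the entry written
`a₁₁₁₂` on paper is `A ![0, 0, 0, 1]`. -/
abbrev RealTensor (m n : ℕ) : Type := (Fin m → Fin n) → ℝ

namespace RealTensor

/-- The entries are invariant under every permutation of the `m` indices. -/
def IsSymmetric {m n : ℕ} (A : RealTensor m n) : Prop :=
  ∀ (σ : Equiv.Perm (Fin m)) (i : Fin m → Fin n), A (i ∘ σ) = A i

/-- The homogeneous polynomial `A xᵐ = ∑ a_{i₁ … iₘ} x_{i₁} ⋯ x_{iₘ}`,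
the sum being over all multi-indices. -/
def form {m n : ℕ} (A : RealTensor m n) (x : Fin n → ℝ) : ℝ :=
  ∑ i : Fin m → Fin n, A i * ∏ j : Fin m, x (i j)

/-- `A` is copositive: `A xᵐ ≥ 0` for every `x` in the nonnegative orthant. -/
def IsCopositive {m n : ℕ} (A : RealTensor m n) : Prop :=
  ∀ x : Fin n → ℝ, (∀ k, 0 ≤ x k) → 0 ≤ A.form x

/-- The invariant `I` of a fourth order two-dimensional symmetric tensor. -/
def invI (A : RealTensor 4 2) : ℝ :=
  A ![0, 0, 0, 0] * A ![1, 1, 1, 1] - 4 * A ![0, 0, 0, 1] * A ![0, 1, 1, 1]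
    + 3 * A ![0, 0, 1, 1] ^ 2

/-- The invariant `J` of a fourth order two-dimensional symmetric tensor. -/
def invJ (A : RealTensor 4 2) : ℝ :=
  A ![0, 0, 0, 0] * A ![0, 0, 1, 1] * A ![1, 1, 1, 1]
    + 2 * A ![0, 0, 0, 1] * A ![0, 0, 1, 1] * A ![0, 1, 1, 1]
    - A ![0, 0, 1, 1] ^ 3
    - A ![0, 0, 0, 0] * A ![0, 1, 1, 1] ^ 2
    - A ![0, 0, 0, 1] ^ 2 * A ![1, 1, 1, 1]

end RealTensor

/-! Evaluating at the basis vectors makes `a1111` and `a2222` positive. Rescaling the axes by their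
fourth roots then reduces copositivity to nonnegativity on `[0, ∞)` of `t⁴ + 4αt³ + 6βt² + 4γt + 1`.

Over the reals this quartic splits as `(t² + mUt + m²)(t² + nWt + n²)` with `m, n > 0` and `mn = 1`
(`exists_balanced_factors`). A factor is negative somewhere on `[0, ∞)` exactly when its `U` or `W`
is below `-2`, so the product is nonnegative there iff `U, W ≥ -2` or the two factors coincide
(`nonneg_factors_iff`).

It remains to express this through the coefficients. The sign of `I³ - 27J²` is governed by `(U² -
4)(W² - 4)` (`quarticDiscr_of_factors`), while `α + γ`, `(α - γ)²` and `6β + 2` are simple in `U +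
W`, `U - W`, `UW` and `(m + n)² ≥ 4`. The regions of the `(U, W)` plane cut out by the lines `U =
±2`, `W = ±2` then match the three conditions. -/

/-! ### Factoring the quartic -/

theorem exists_pos_root_of_cubic {b c d : ℝ} (hd : d < 0) :
    ∃ y : ℝ, 0 < y ∧ y ^ 3 + b * y ^ 2 + c * y + d = 0 := by
  -- Since `M ≥ 1`, the cubic term `M · M² = (1 + |b| + |c| + |d|) M²` dominates the others.
  set M : ℝ := 1 + |b| + |c| + |d| with hM
  have hb := neg_abs_le b
  have hc := neg_abs_le c
  have hd' := neg_abs_le d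
  have hb0 := abs_nonneg b
  have hc0 := abs_nonneg c
  have hd0 := abs_nonneg d
  have hM1 : 1 ≤ M := by linarith
  have hval : 0 ≤ M ^ 3 + b * M ^ 2 + c * M + d := by
    have h1 : M ^ 3 = M ^ 2 + |b| * M ^ 2 + |c| * M ^ 2 + |d| * M ^ 2 := by
      have : M ^ 3 = M * M ^ 2 := by ring
      rw [this]; nth_rw 1 [hM]; ring
    have h2 : -|b| * M ^ 2 ≤ b * M ^ 2 := by gcongr
    have h3 : -|c| * M ≤ c * M := by gcongr
    have h4 : M ≤ M ^ 2 := by nlinarith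
    have h5 : |c| * M ≤ |c| * M ^ 2 := by gcongr
    have h6 : |d| * 1 ≤ |d| * M ^ 2 := by gcongr; linarith
    nlinarith [sq_nonneg M]
  obtain ⟨y, hy, hy0⟩ : (0 : ℝ) ∈ (fun y : ℝ => y ^ 3 + b * y ^ 2 + c * y + d) '' Set.Icc 0 M := by
    apply intermediate_value_Icc (by linarith) (by fun_prop)
    constructor
    · simpa using hd.le
    · exact hval
  refine ⟨y, lt_of_le_of_ne hy.1 ?_, hy0⟩
  rintro rfl
  simp at hy0
  linarith

/-- A monic real quartic with constant term `1` is a product of two monic real quadratics with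
positive constant terms. -/
theorem exists_quadratic_factors (a b c : ℝ) :
    ∃ u v w z : ℝ, 0 < v ∧ v * z = 1 ∧ a = u + w ∧ b = v + z + u * w ∧ c = u * z + v * w := by
  by_cases hroot : ∃ x : ℝ, x ^ 4 + a * x ^ 3 + b * x ^ 2 + c * x + 1 = 0
  · obtain ⟨x, hx⟩ := hroot
    have hx0 : x ≠ 0 := by rintro rfl; simp at hx
    -- The cubic left after dividing by `t - x` has constant term `-1/x`, hence a root on the same
    -- side of `0` as `x`. Pairing the two roots gives a factor with positive constant term `xy`.
    obtain ⟨y, hxy, hy⟩ : ∃ y : ℝ, 0 < x * y ∧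
        y ^ 3 + (a + x) * y ^ 2 + (b + x * (a + x)) * y + (c + x * (b + x * (a + x))) = 0 := by
      have hd : x * (c + x * (b + x * (a + x))) = -1 := by linarith
      rcases lt_or_gt_of_ne hx0 with h | h
      · obtain ⟨y, hy, hy'⟩ := exists_pos_root_of_cubic (b := -(a + x)) (c := b + x * (a + x))
          (d := -(c + x * (b + x * (a + x)))) (by nlinarith)
        exact ⟨-y, by nlinarith, by linear_combination -hy'⟩
      · obtain ⟨y, hy, hy'⟩ := exists_pos_root_of_cubic (b := a + x) (c := b + x * (a + x))
          (d := c + x * (b + x * (a + x))) (by nlinarith)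
        exact ⟨y, by positivity, hy'⟩
    refine ⟨-(x + y), x * y, a + x + y, b + x * (a + x) + y * (a + x + y), hxy, ?_, ?_, ?_, ?_⟩
    · linear_combination x * hy - hx
    · ring
    · ring
    · linear_combination hy
  · push Not at hroot
    obtain ⟨ζ, hζ⟩ : ∃ ζ : ℂ, ζ ^ 4 + a * ζ ^ 3 + b * ζ ^ 2 + c * ζ + 1 = 0 := by
      let p : Polynomial ℂ := Polynomial.X ^ 4 + (Polynomial.C (a : ℂ) * Polynomial.X ^ 3 +
        Polynomial.C (b : ℂ) * Polynomial.X ^ 2 + Polynomial.C (c : ℂ) * Polynomial.X + 1)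
      have hp : p.degree = 4 := by
        simp only [p]; compute_degree!
      obtain ⟨ζ, h⟩ := Complex.exists_root (f := p) (by rw [hp]; norm_num)
      refine ⟨ζ, ?_⟩
      simp only [p, Polynomial.IsRoot.def, Polynomial.eval_add, Polynomial.eval_mul,
        Polynomial.eval_pow, Polynomial.eval_X, Polynomial.eval_C, Polynomial.eval_one] at h
      linear_combination h
    obtain ⟨x, y⟩ := ζ
    have hre := congrArg Complex.re hζ
    have him := congrArg Complex.im hζ
    simp [pow_succ] at hre him
    have hy : y ≠ 0 := by
      rintro rfl
      apply hroot x
      linear_combination hre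
    -- `t² + wt + z` is the quotient by `(t - ζ)(t - ζ̄)`; `hr` and `hs` say that the remainder
    -- vanishes.
    set w := a + 2 * x with hw
    set z := b - (x ^ 2 + y ^ 2) + 2 * x * w with hz
    have hr : c - (x ^ 2 + y ^ 2) * w + 2 * x * z = 0 := by
      apply mul_left_cancel₀ hy
      rw [hz, hw]
      linear_combination him
    have hs : 1 - (x ^ 2 + y ^ 2) * z = 0 := by
      rw [hz, hw] at hr ⊢
      linear_combination hre - x * hr
    refine ⟨-2 * x, x ^ 2 + y ^ 2, w, z, by positivity, by linarith, by rw [hw]; ring,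
      by rw [hz]; ring, by linear_combination hr⟩

/-- `t ^ 4 + 4 α t ^ 3 + 6 β t ^ 2 + 4 γ t + 1 = (t² + m U t + m²) (t² + n W t + n²)`, `m n = 1`. -/
theorem exists_balanced_factors (α β γ : ℝ) :
    ∃ m n U W : ℝ, 0 < m ∧ 0 < n ∧ m * n = 1 ∧ 4 * α = m * U + n * W ∧
      6 * β = m ^ 2 + n ^ 2 + U * W ∧ 4 * γ = n * U + m * W := by
  obtain ⟨u, v, w, z, hv, hvz, ha, hb, hc⟩ := exists_quadratic_factors (4 * α) (6 * β) (4 * γ)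
  have hm : 0 < √v := Real.sqrt_pos.2 hv
  have hm2 : √v ^ 2 = v := Real.sq_sqrt hv.le
  have hz : z = ((√v)⁻¹) ^ 2 := by
    rw [inv_pow, hm2]; exact eq_inv_of_mul_eq_one_right hvz
  generalize √v = m at *
  subst hm2 hz
  refine ⟨m, m⁻¹, u / m, m * w, hm, inv_pos.2 hm, mul_inv_cancel₀ hm.ne', ?_, ?_, ?_⟩
  · rw [ha]; field_simp
  · rw [hb]; field_simp
  · rw [hc]; field_simp

/-! ### The discriminant -/

def quarticDiscr (α β γ : ℝ) : ℝ :=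
  (1 - 4 * α * γ + 3 * β ^ 2) ^ 3 -
    27 * (β + 2 * α * β * γ - β ^ 3 - γ ^ 2 - α ^ 2) ^ 2

/-- The discriminant of a product is the product of the discriminants, here `m²(U² - 4)` and `n²(W²
- 4)`, times the squared resultant. -/
theorem quarticDiscr_of_factors {α β γ m n U W : ℝ} (hmn : m * n = 1)
    (hα : 4 * α = m * U + n * W) (hβ : 6 * β = m ^ 2 + n ^ 2 + U * W)
    (hγ : 4 * γ = n * U + m * W) :
    256 * quarticDiscr α β γ = (U ^ 2 - 4) * (W ^ 2 - 4) *
      ((m ^ 2 - n ^ 2) ^ 2 - (m * U - n * W) * (m * W - n * U)) ^ 2 := by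
  have hα' : α = (m * U + n * W) / 4 := by linarith
  have hβ' : β = (m ^ 2 + n ^ 2 + U * W) / 6 := by linarith
  have hγ' : γ = (n * U + m * W) / 4 := by linarith
  have hn : n = 1 / m := eq_one_div_of_mul_eq_one_right hmn
  have hm : m ≠ 0 := left_ne_zero_of_mul_eq_one hmn
  subst hα' hβ' hγ' hn
  unfold quarticDiscr
  field_simp
  ring

/-! ### Nonnegativity in terms of the factors -/

theorem roots_nested {r₁ r₂ s₁ s₂ : ℝ} (hr₁ : 0 < r₁) (hr : r₁ < r₂) (hs : s₁ ≤ s₂)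
    (h : ∀ t : ℝ, 0 ≤ t → 0 ≤ ((t - r₁) * (t - r₂)) * ((t - s₁) * (t - s₂))) :
    s₁ ≤ r₁ ∧ r₂ ≤ s₂ := by
  constructor
  · by_contra! hlt
    obtain ⟨t, h1, h2⟩ := exists_between (lt_min hlt hr)
    obtain ⟨h3, h4⟩ := lt_min_iff.1 h2
    have := h t (hr₁.trans h1).le
    have hA : (t - r₁) * (t - r₂) < 0 := mul_neg_of_pos_of_neg (by linarith) (by linarith)
    have hB : 0 < (t - s₁) * (t - s₂) := mul_pos_of_neg_of_neg (by linarith) (by linarith)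
    linarith [mul_neg_of_neg_of_pos hA hB]
  · by_contra! hlt
    obtain ⟨t, h1, h2⟩ := exists_between (max_lt hlt hr)
    obtain ⟨h3, h4⟩ := max_lt_iff.1 h1
    have := h t (hr₁.trans h4).le
    have hA : (t - r₁) * (t - r₂) < 0 := mul_neg_of_pos_of_neg (by linarith) (by linarith)
    have hB : 0 < (t - s₁) * (t - s₂) := mul_pos (by linarith) (by linarith)
    linarith [mul_neg_of_neg_of_pos hA hB]

theorem exists_pos_roots {m U : ℝ} (hm : 0 < m) (hU : U ≤ -2) :
    ∃ r₁ r₂ : ℝ, 0 < r₁ ∧ r₁ ≤ r₂ ∧ r₁ * r₂ = m ^ 2 ∧ r₁ + r₂ = -(m * U) ∧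
      (U < -2 → r₁ < r₂) := by
  have hD : 0 ≤ U ^ 2 - 4 := by nlinarith
  have hs := Real.sq_sqrt hD
  have hs0 := Real.sqrt_nonneg (U ^ 2 - 4)
  have hlt : √(U ^ 2 - 4) < -U := by
    rw [Real.sqrt_lt' (by linarith)]; linarith [neg_sq U]
  refine ⟨m * ((-U - √(U ^ 2 - 4)) / 2), m * ((-U + √(U ^ 2 - 4)) / 2), ?_, ?_, ?_, ?_, ?_⟩
  · exact mul_pos hm (by linarith)
  · gcongr; linarith
  · linear_combination (-m ^ 2 / 4) * hs
  · ring
  · intro h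
    have : 0 < √(U ^ 2 - 4) := Real.sqrt_pos.2 (by nlinarith)
    gcongr; linarith

/-- Where one factor is negative on the positive axis the other must be nonpositive, so the root
intervals contain each other and both factors have the same roots. -/
theorem factors_eq_of_nonneg {m n U W : ℝ} (hm : 0 < m) (hn : 0 < n) (hmn : m * n = 1)
    (h : ∀ t : ℝ, 0 ≤ t →
      0 ≤ (t ^ 2 + m * U * t + m ^ 2) * (t ^ 2 + n * W * t + n ^ 2))
    (hU : U < -2) : m = n ∧ U = W := by
  have hW : W ≤ -2 := by
    -- At `t = m` the first factor is `m²(U + 2) < 0` and the second is `m² + n² + W`, with `m² + n²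
    -- ≥ 2`.
    have h1 := h m hm.le
    have h2 : m ^ 2 + m * U * m + m ^ 2 < 0 := by nlinarith [sq_pos_of_pos hm]
    have h3 : m ^ 2 + n * W * m + n ^ 2 ≤ 0 := by
      by_contra! h3
      linarith [mul_neg_of_neg_of_pos h2 h3]
    nlinarith [sq_nonneg (m - n)]
  obtain ⟨r₁, r₂, hr₁, -, hrm, hrU, hr⟩ := exists_pos_roots hm hU.le
  obtain ⟨s₁, s₂, hs₁, hs, hsm, hsW, -⟩ := exists_pos_roots hn hW
  have hfac : ∀ t : ℝ, (t ^ 2 + m * U * t + m ^ 2) * (t ^ 2 + n * W * t + n ^ 2) =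
      ((t - r₁) * (t - r₂)) * ((t - s₁) * (t - s₂)) := by
    intro t
    have e1 : t ^ 2 + m * U * t + m ^ 2 = (t - r₁) * (t - r₂) := by
      linear_combination -hrm + t * hrU
    have e2 : t ^ 2 + n * W * t + n ^ 2 = (t - s₁) * (t - s₂) := by
      linear_combination -hsm + t * hsW
    rw [e1, e2]
  simp only [hfac] at h
  obtain ⟨h1, h2⟩ := roots_nested hr₁ (hr hU) hs h
  obtain ⟨h3, h4⟩ := roots_nested hs₁ (h1.trans_lt ((hr hU).trans_le h2)) (hr hU).le
    (fun t ht => by linarith [h t ht])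
  have e1 : r₁ = s₁ := le_antisymm h3 h1
  have e2 : r₂ = s₂ := le_antisymm h2 h4
  have hmn' : m = n := by
    rw [← pow_left_inj₀ hm.le hn.le two_ne_zero, ← hrm, ← hsm, e1, e2]
  refine ⟨hmn', ?_⟩
  rw [e1, e2, hsW, hmn'] at hrU
  exact (mul_left_cancel₀ hn.ne' (neg_inj.1 hrU)).symm

theorem nonneg_factors_iff {m n U W : ℝ} (hm : 0 < m) (hn : 0 < n) (hmn : m * n = 1) :
    (∀ t : ℝ, 0 ≤ t → 0 ≤ (t ^ 2 + m * U * t + m ^ 2) * (t ^ 2 + n * W * t + n ^ 2)) ↔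
      (-2 ≤ U ∧ -2 ≤ W) ∨ (m = n ∧ U = W) := by
  constructor
  · intro h
    by_cases hU : U < -2
    · exact .inr (factors_eq_of_nonneg hm hn hmn h hU)
    by_cases hW : W < -2
    · obtain ⟨h1, h2⟩ := factors_eq_of_nonneg hn hm (by linarith)
        (fun t ht => (h t ht).trans_eq (mul_comm _ _)) hW
      exact .inr ⟨h1.symm, h2.symm⟩
    · exact .inl ⟨not_lt.1 hU, not_lt.1 hW⟩
  · rintro (⟨hU, hW⟩ | ⟨rfl, rfl⟩) t ht
    · have h1 : 0 ≤ m * t * (U + 2) := mul_nonneg (by positivity) (by linarith)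
      have h2 : 0 ≤ n * t * (W + 2) := mul_nonneg (by positivity) (by linarith)
      apply mul_nonneg
      · nlinarith [sq_nonneg (t - m)]
      · nlinarith [sq_nonneg (t - n)]
    · exact mul_self_nonneg _

/-! ### From the factors to the coefficient conditions -/

def NormalizedConditions (α β γ : ℝ) : Prop :=
  (quarticDiscr α β γ ≤ 0 ∧ 0 < α + γ) ∨ (0 ≤ γ ∧ 0 ≤ α ∧ 0 ≤ 3 * β + 1) ∨
    (0 ≤ quarticDiscr α β γ ∧ |α - γ| ≤ √(6 * β + 2) ∧
      ((-1 ≤ 3 * β ∧ β ≤ 1) ∨ (1 < β ∧ -√(6 * β - 2) ≤ α + γ)))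

section Factors

variable {α β γ m n U W : ℝ} (hm : 0 < m) (hn : 0 < n) (hmn : m * n = 1)
  (hα : 4 * α = m * U + n * W) (hβ : 6 * β = m ^ 2 + n ^ 2 + U * W)
  (hγ : 4 * γ = n * U + m * W)

include hmn in
theorem four_le_sq_add : 4 ≤ (m + n) ^ 2 := by nlinarith [sq_nonneg (m - n)]

include hmn hα hγ in
theorem sq_sub_of_factors : 16 * (α - γ) ^ 2 = ((m + n) ^ 2 - 4) * (U - W) ^ 2 := by
  linear_combination (4 * (α - γ) + (m - n) * (U - W)) * (hα - hγ) - 4 * (U - W) ^ 2 * hmn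

include hα hγ in
theorem add_of_factors : 4 * (α + γ) = (m + n) * (U + W) := by
  linear_combination hα + hγ

include hmn hβ in
theorem six_mul_add_two_of_factors : 6 * β + 2 = (m + n) ^ 2 + U * W := by
  linear_combination hβ - 2 * hmn

include hα hγ in
theorem sq_add_of_factors : 16 * (α + γ) ^ 2 = (m + n) ^ 2 * (U + W) ^ 2 := by
  have := add_of_factors hα hγ
  linear_combination (4 * (α + γ) + (m + n) * (U + W)) * this

include hmn hα hβ hγ in
-- The square `|U|, |W| ≤ 2` falls under the third condition, since there `(U² - 4)(W² - 4) ≥ 0`.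
theorem normalizedConditions_of_abs_le_two (hU : -2 ≤ U) (hU' : U ≤ 2) (hW : -2 ≤ W)
    (hW' : W ≤ 2) : NormalizedConditions α β γ := by
  have hk := four_le_sq_add hmn
  have hd := sq_sub_of_factors hmn hα hγ
  have hs := sq_add_of_factors hα hγ
  have hb := six_mul_add_two_of_factors hmn hβ
  set k := (m + n) ^ 2
  have hP : -4 ≤ U * W := by nlinarith
  refine .inr (.inr ⟨?_, ?_, ?_⟩)
  · have h := quarticDiscr_of_factors hmn hα hβ hγ
    have h1 : 0 ≤ (U ^ 2 - 4) * (W ^ 2 - 4) :=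
      mul_nonneg_of_nonpos_of_nonpos (by nlinarith) (by nlinarith)
    have := mul_nonneg h1 (sq_nonneg ((m ^ 2 - n ^ 2) ^ 2 - (m * U - n * W) * (m * W - n * U)))
    linarith
  · apply Real.abs_le_sqrt
    have h1 : (U - W) ^ 2 ≤ 16 := by nlinarith
    have h2 : 0 ≤ k * (16 - (U - W) ^ 2) := mul_nonneg (by linarith) (by linarith)
    nlinarith [sq_nonneg (U + W)]
  · by_cases hβ1 : β ≤ 1
    · exact .inl ⟨by linarith, hβ1⟩
    push Not at hβ1
    refine .inr ⟨hβ1, ?_⟩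
    apply neg_le_of_abs_le
    apply Real.abs_le_sqrt
    -- With `s = |U + W|` and `k > 8 - UW` (from `β > 1`), the gap `16(6β - 2) - k s²` is at least
    -- `64 - 8s² + UW s²`. The bound `UW ≥ 2s - 4` makes this at least `2(s - 4)²(s + 2) ≥ 0`.
    have h16 : (U + W) ^ 2 ≤ 16 := by nlinarith
    have h1 : 0 ≤ (k - (8 - U * W)) * (16 - (U + W) ^ 2) :=
      mul_nonneg (by linarith) (by linarith)
    have habs : |U + W| ≤ 4 := abs_le.2 ⟨by linarith, by linarith⟩
    have hP2 : 2 * |U + W| - 4 ≤ U * W := by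
      have e1 := mul_nonneg (sub_nonneg.2 hU') (sub_nonneg.2 hW')
      have e2 := mul_nonneg (neg_le_iff_add_nonneg.1 hU) (neg_le_iff_add_nonneg.1 hW)
      rcases abs_cases (U + W) with ⟨h, -⟩ | ⟨h, -⟩ <;> rw [h] <;> linarith
    have h2 : 0 ≤ (U * W - (2 * |U + W| - 4)) * (U + W) ^ 2 :=
      mul_nonneg (by linarith) (sq_nonneg _)
    have h3 : 0 ≤ 64 - 12 * (U + W) ^ 2 + 2 * |U + W| * (U + W) ^ 2 := by
      rw [← sq_abs (U + W)]
      have := mul_nonneg (sq_nonneg (|U + W| - 4)) (by positivity : 0 ≤ |U + W| + 2)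
      linarith
    linarith

include hmn hα hβ hγ in
theorem normalizedConditions_of_two_le_right (hU : -2 ≤ U) (hU' : U ≤ 2) (hW : 2 ≤ W)
    (h0 : 0 < m + n) : NormalizedConditions α β γ := by
  -- Equality occurs only at the corner `U = -2`, `W = 2`, which belongs to the previous case.
  rcases (show 0 ≤ U + W by linarith).eq_or_lt with h | h
  · exact normalizedConditions_of_abs_le_two hmn hα hβ hγ hU hU' (by linarith) (by linarith)
  · refine .inl ⟨?_, ?_⟩
    · have h := quarticDiscr_of_factors hmn hα hβ hγ
      have h1 : (U ^ 2 - 4) * (W ^ 2 - 4) ≤ 0 :=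
        mul_nonpos_of_nonpos_of_nonneg (by nlinarith) (by nlinarith)
      have := mul_nonpos_of_nonpos_of_nonneg h1
        (sq_nonneg ((m ^ 2 - n ^ 2) ^ 2 - (m * U - n * W) * (m * W - n * U)))
      linarith
    · have := mul_pos h0 h
      linarith [add_of_factors hα hγ]

include hm hn hmn hα hβ hγ in
theorem normalizedConditions_of_neg_two_le (hU : -2 ≤ U) (hW : -2 ≤ W) :
    NormalizedConditions α β γ := by
  rcases le_total U 2 with hU' | hU' <;> rcases le_total W 2 with hW' | hW'
  · exact normalizedConditions_of_abs_le_two hmn hα hβ hγ hU hU' hW hW'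
  · exact normalizedConditions_of_two_le_right hmn hα hβ hγ hU hU' hW' (by linarith)
  · exact normalizedConditions_of_two_le_right (m := n) (n := m) (U := W) (W := U)
      (by linarith) (by linarith) (by linarith) (by linarith) hW hW' hU' (by linarith)
  · have h1 : 0 ≤ n * U := by positivity
    have h2 : 0 ≤ n * W := by positivity
    have h3 : 0 ≤ m * U := by positivity
    have h4 : 0 ≤ m * W := by positivity
    have h5 : 0 ≤ U * W := by positivity
    exact .inr (.inl ⟨by linarith, by linarith, by nlinarith⟩)

end Factors

/-- For a perfect square the resultant vanishes, and `(α + γ)² = U² = 6β - 2`: the last bound of the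
third condition is sharp. -/
theorem normalizedConditions_of_factors_eq {α β γ m U : ℝ} (hmn : m * m = 1)
    (hα : 4 * α = m * U + m * U) (hβ : 6 * β = m ^ 2 + m ^ 2 + U * U)
    (hγ : 4 * γ = m * U + m * U) (hU : U ^ 2 > 4) : NormalizedConditions α β γ := by
  refine .inr (.inr ⟨?_, ?_, .inr ⟨?_, ?_⟩⟩)
  · have := quarticDiscr_of_factors hmn hα hβ hγ
    ring_nf at this
    linarith
  · rw [show α - γ = 0 by linarith, abs_zero]
    exact Real.sqrt_nonneg _
  · nlinarith
  · apply neg_le_of_abs_le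
    apply Real.abs_le_sqrt
    have h : α + γ = m * U := by linarith
    rw [h]
    nlinarith

/-! ### From the coefficient conditions back to the factors -/

section Factors

variable {α β γ m n U W : ℝ} (hm : 0 < m) (hn : 0 < n) (hmn : m * n = 1)
  (hα : 4 * α = m * U + n * W) (hβ : 6 * β = m ^ 2 + n ^ 2 + U * W)
  (hγ : 4 * γ = n * U + m * W)

include hm hn hmn hα hβ hγ in
-- If `U < -2`, then `U + W > 0` forces `W > 2`. Now `UW < 0` makes the resultant positive, and the
-- discriminant would be positive.
theorem neg_two_le_of_quarticDiscr_nonpos (hΔ : quarticDiscr α β γ ≤ 0) (hs : 0 < α + γ) :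
    -2 ≤ U := by
  by_contra! hU
  have hUW : 0 < U + W := by
    have := add_of_factors hα hγ
    exact pos_of_mul_pos_right (by linarith : 0 < (m + n) * (U + W)) (by linarith)
  have hR : 0 < (m ^ 2 - n ^ 2) ^ 2 - (m * U - n * W) * (m * W - n * U) := by
    have e : (m ^ 2 - n ^ 2) ^ 2 - (m * U - n * W) * (m * W - n * U) =
        (m ^ 2 - n ^ 2) ^ 2 + (U ^ 2 + W ^ 2) + -(U * W) * (m ^ 2 + n ^ 2) := by
      linear_combination (U ^ 2 + W ^ 2) * hmn
    rw [e]
    have h1 : 0 < -(U * W) := by nlinarith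
    have : 0 < W := by linarith
    positivity
  have h1 : 0 < U ^ 2 - 4 := by nlinarith
  have h2 : 0 < W ^ 2 - 4 := by nlinarith
  have := quarticDiscr_of_factors hmn hα hβ hγ
  have h3 := mul_pos (mul_pos h1 h2) (pow_pos hR 2)
  linarith

include hm hn hmn hα hβ hγ in
-- One factor has real roots and the other does not, so the resultant is nonzero and the
-- discriminant is negative.
theorem not_quarticDiscr_nonneg (hU : U < -2) (hW : W ^ 2 < 4) :
    ¬ 0 ≤ quarticDiscr α β γ := by
  intro hΔ
  have h := quarticDiscr_of_factors hmn hα hβ hγ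
  have hR : 0 < (m ^ 2 - n ^ 2) ^ 2 - (m * U - n * W) * (m * W - n * U) := by
    have e : 4 * ((m ^ 2 - n ^ 2) ^ 2 - (m * U - n * W) * (m * W - n * U)) =
        (2 * U - W * (m ^ 2 + n ^ 2)) ^ 2 + (m ^ 2 - n ^ 2) ^ 2 * (4 - W ^ 2) := by
      linear_combination (4 * (U ^ 2 + W ^ 2) - 4 * W ^ 2 * (m * n + 1)) * hmn
    by_cases hmn' : m ^ 2 = n ^ 2
    · have hm1 : m = n := (pow_left_inj₀ hm.le hn.le two_ne_zero).1 hmn'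
      subst hm1
      have hne : 2 * U - W * (m ^ 2 + m ^ 2) ≠ 0 := by
        rw [show m ^ 2 = 1 by linarith]
        have : -2 < W := (abs_lt_of_sq_lt_sq (by linarith) (by norm_num : (0 : ℝ) ≤ 2) |> abs_lt.1).1
        intro h0
        linarith
      have : 0 < (2 * U - W * (m ^ 2 + m ^ 2)) ^ 2 := by positivity
      nlinarith
    · have h1 : 0 < (m ^ 2 - n ^ 2) ^ 2 := sq_pos_of_ne_zero (sub_ne_zero.2 hmn')
      have := mul_pos h1 (by linarith : 0 < 4 - W ^ 2)
      nlinarith [sq_nonneg (2 * U - W * (m ^ 2 + n ^ 2))]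
  have h1 : 0 < U ^ 2 - 4 := by nlinarith
  have h3 := mul_pos (mul_pos h1 (by linarith : 0 < 4 - W ^ 2)) (pow_pos hR 2)
  linarith

include hm hn hmn hα hβ hγ in
-- Given `U < -2`, the discriminant excludes `|W| < 2`, the bound on `|α - γ|` excludes `W ≥ 2`, and
-- `W ≤ -2` gives `β > 1`. The bound on `α + γ` then leaves only equal factors.
theorem factors_eq_of_quarticDiscr_nonneg (hΔ : 0 ≤ quarticDiscr α β γ)
    (hd : |α - γ| ≤ √(6 * β + 2))
    (hc : (-1 ≤ 3 * β ∧ β ≤ 1) ∨ (1 < β ∧ -√(6 * β - 2) ≤ α + γ)) (hU : U < -2) :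
    m = n ∧ U = W := by
  have hk := four_le_sq_add hmn
  have hd' := sq_sub_of_factors hmn hα hγ
  have ha := add_of_factors hα hγ
  have hs := sq_add_of_factors hα hγ
  have hb := six_mul_add_two_of_factors hmn hβ
  have hk' : (m + n) ^ 2 = 4 → m = n := fun h => by
    have : (m - n) ^ 2 = 0 := by linarith
    exact sub_eq_zero.1 (pow_eq_zero_iff two_ne_zero |>.1 this)
  have hmn0 : 0 < m + n := by linarith
  have hW2 : 4 ≤ W ^ 2 := by
    by_contra! hW
    exact not_quarticDiscr_nonneg hm hn hmn hα hβ hγ hU hW hΔ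
  have hβ0 : 0 ≤ 6 * β + 2 := by rcases hc with h | h <;> linarith [h.1]
  have hdsq : (α - γ) ^ 2 ≤ 6 * β + 2 := by
    rw [← sq_abs, ← Real.sq_sqrt hβ0]
    gcongr
  have hW : W ≤ -2 := by
    by_contra! hW
    have hW' : 2 ≤ W := by nlinarith
    have hP : U * W < -4 := by nlinarith
    have h16 : 16 < (U - W) ^ 2 := by nlinarith
    have : 0 ≤ ((m + n) ^ 2 - 4) * ((U - W) ^ 2 - 16) :=
      mul_nonneg (by linarith) (by linarith)
    nlinarith
  have hP : 4 < U * W := by nlinarith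
  rcases hc with ⟨-, h1⟩ | ⟨h1, h2⟩
  · linarith
  have hneg : α + γ < 0 := by
    have := mul_neg_of_pos_of_neg hmn0 (by linarith : U + W < 0)
    linarith
  have hsq : (α + γ) ^ 2 ≤ 6 * β - 2 := by
    rw [← neg_sq, ← Real.sq_sqrt (by linarith : 0 ≤ 6 * β - 2)]
    have : 0 ≤ -(α + γ) := by linarith
    gcongr
    linarith
  have hs16 : 16 < (U + W) ^ 2 := by nlinarith
  -- Combined with `hsq`, this product yields `4(U + W)² ≤ 16UW`, that is `(U - W)² ≤ 0`.
  have hmul : 0 ≤ ((m + n) ^ 2 - 4) * ((U + W) ^ 2 - 16) :=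
    mul_nonneg (by linarith) (by linarith)
  have hUW : U = W := by
    have : (U - W) ^ 2 ≤ 0 := by nlinarith
    exact sub_eq_zero.1 (pow_eq_zero_iff two_ne_zero |>.1 (le_antisymm this (sq_nonneg _)))
  refine ⟨hk' (le_antisymm ?_ hk), hUW⟩
  subst hUW
  nlinarith

end Factors

/-! ### The criterion for the normalized quartic -/

theorem forall_quartic_nonneg_iff (α β γ : ℝ) :
    (∀ t : ℝ, 0 ≤ t → 0 ≤ t ^ 4 + 4 * α * t ^ 3 + 6 * β * t ^ 2 + 4 * γ * t + 1) ↔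
      NormalizedConditions α β γ := by
  obtain ⟨m, n, U, W, hm, hn, hmn, hα, hβ, hγ⟩ := exists_balanced_factors α β γ
  have hfac : ∀ t : ℝ, t ^ 4 + 4 * α * t ^ 3 + 6 * β * t ^ 2 + 4 * γ * t + 1 =
      (t ^ 2 + m * U * t + m ^ 2) * (t ^ 2 + n * W * t + n ^ 2) := fun t => by
    rw [hα, hβ, hγ]
    linear_combination (-(U * W * t ^ 2 + (n * U + m * W) * t + m * n + 1)) * hmn
  simp only [hfac]
  rw [nonneg_factors_iff hm hn hmn]
  have hα' : 4 * α = n * W + m * U := by linarith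
  have hβ' : 6 * β = n ^ 2 + m ^ 2 + W * U := by linarith
  have hγ' : 4 * γ = m * W + n * U := by linarith
  have hnm : n * m = 1 := by linarith
  constructor
  · intro h
    by_cases h2 : -2 ≤ U ∧ -2 ≤ W
    · exact normalizedConditions_of_neg_two_le hm hn hmn hα hβ hγ h2.1 h2.2
    · obtain ⟨rfl, rfl⟩ := h.resolve_left h2
      exact normalizedConditions_of_factors_eq hmn hα hβ hγ (by
        rw [and_self, not_le] at h2; nlinarith)
  · rintro (⟨h1, h2⟩ | ⟨h1, h2, h3⟩ | ⟨h1, h2, h3⟩)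
    · exact .inl ⟨neg_two_le_of_quarticDiscr_nonpos hm hn hmn hα hβ hγ h1 h2,
        neg_two_le_of_quarticDiscr_nonpos hn hm hnm hα' hβ' hγ' h1 h2⟩
    · rw [← nonneg_factors_iff hm hn hmn]
      intro t ht
      rw [← hfac]
      -- The quartic is `(t² - 1)² + 2(3β + 1)t²` plus these two terms.
      have e : 0 ≤ 4 * α * t ^ 3 + 4 * γ * t := by positivity
      have e2 : 0 ≤ 2 * (3 * β + 1) * t ^ 2 := by positivity
      nlinarith [sq_nonneg (t ^ 2 - 1)]
    · by_cases hU : U < -2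
      · exact .inr (factors_eq_of_quarticDiscr_nonneg hm hn hmn hα hβ hγ h1 h2 h3 hU)
      by_cases hW : W < -2
      · obtain ⟨e1, e2⟩ :=
          factors_eq_of_quarticDiscr_nonneg hn hm hnm hα' hβ' hγ' h1 h2 h3 hW
        exact .inr ⟨e1.symm, e2.symm⟩
      · exact .inl ⟨not_lt.1 hU, not_lt.1 hW⟩

/-! ### Reduction of the tensor to the quartic -/

namespace RealTensor

theorem IsSymmetric.form_four_two {A : RealTensor 4 2} (hA : A.IsSymmetric) (x : Fin 2 → ℝ) :
    A.form x = A ![0, 0, 0, 0] * x 0 ^ 4 + 4 * A ![0, 0, 0, 1] * x 0 ^ 3 * x 1 +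
      6 * A ![0, 0, 1, 1] * x 0 ^ 2 * x 1 ^ 2 + 4 * A ![0, 1, 1, 1] * x 0 * x 1 ^ 3 +
      A ![1, 1, 1, 1] * x 1 ^ 4 := by
  -- Adjacent transpositions suffice to sort every multi-index.
  have s01 : ∀ a b c d, A ![b, a, c, d] = A ![a, b, c, d] := fun a b c d => by
    rw [← hA (Equiv.swap 0 1) ![a, b, c, d]]
    congr 1; ext j; fin_cases j <;> rfl
  have s12 : ∀ a b c d, A ![a, c, b, d] = A ![a, b, c, d] := fun a b c d => by
    rw [← hA (Equiv.swap 1 2) ![a, b, c, d]]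
    congr 1; ext j; fin_cases j <;> rfl
  have s23 : ∀ a b c d, A ![a, b, d, c] = A ![a, b, c, d] := fun a b c d => by
    rw [← hA (Equiv.swap 2 3) ![a, b, c, d]]
    congr 1; ext j; fin_cases j <;> rfl
  have hsum : A.form x = ∑ a : Fin 2, ∑ b : Fin 2, ∑ c : Fin 2, ∑ d : Fin 2,
      A ![a, b, c, d] * (x a * x b * x c * x d) := by
    unfold form
    rw [← (Fin.consEquiv fun _ : Fin 4 => Fin 2).sum_comp, Fintype.sum_prod_type]
    refine Finset.sum_congr rfl fun a _ => ?_
    rw [← (Fin.consEquiv fun _ : Fin 3 => Fin 2).sum_comp, Fintype.sum_prod_type]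
    refine Finset.sum_congr rfl fun b _ => ?_
    rw [← (Fin.consEquiv fun _ : Fin 2 => Fin 2).sum_comp, Fintype.sum_prod_type]
    refine Finset.sum_congr rfl fun c _ => ?_
    rw [← (Fin.consEquiv fun _ : Fin 1 => Fin 2).sum_comp, Fintype.sum_prod_type]
    refine Finset.sum_congr rfl fun d _ => ?_
    rw [Fintype.sum_unique]
    congr 1
    rw [Fin.prod_univ_four]
    rfl
  rw [hsum]
  simp only [Fin.sum_univ_two]
  rw [s23 1 1 0 1, s12 1 0 1 1, s12 1 0 1 0, s01 0 1 1 1, s01 0 1 1 0, s01 0 1 0 1,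
    s01 0 1 0 0, s12 0 0 1 0, s23 0 0 0 1, s23 0 1 0 1, s12 0 0 1 1]
  ring

theorem isCopositive_iff_forall_quartic {A : RealTensor 4 2} (hA : A.IsSymmetric)
    {p q α β γ : ℝ} (hp : 0 < p) (hq : 0 < q)
    (h1111 : A ![0, 0, 0, 0] = p ^ 4) (h1112 : A ![0, 0, 0, 1] = α * (p ^ 3 * q))
    (h1122 : A ![0, 0, 1, 1] = β * (p ^ 2 * q ^ 2)) (h1222 : A ![0, 1, 1, 1] = γ * (p * q ^ 3))
    (h2222 : A ![1, 1, 1, 1] = q ^ 4) :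
    A.IsCopositive ↔
      ∀ t : ℝ, 0 ≤ t → 0 ≤ t ^ 4 + 4 * α * t ^ 3 + 6 * β * t ^ 2 + 4 * γ * t + 1 := by
  unfold IsCopositive
  simp only [hA.form_four_two, h1111, h1112, h1122, h1222, h2222]
  constructor
  · intro h t ht
    have := h ![t / p, 1 / q] (by
      intro k; fin_cases k
      · exact div_nonneg ht hp.le
      · exact (one_div_pos.2 hq).le)
    simp only [Matrix.cons_val_zero, Matrix.cons_val_one] at this
    exact this.trans_eq (by field_simp)
  · intro h x hx
    -- On the axis `x 1 = 0`, out of reach of `t = p x₀ / (q x₁)`, the form is `p⁴ x₀⁴`.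
    rcases (hx 1).eq_or_lt with h1 | h1
    · rw [← h1]
      have := hx 0
      ring_nf
      positivity
    · have := mul_nonneg (h (p * x 0 / (q * x 1)) (div_nonneg (mul_nonneg hp.le (hx 0))
        (by positivity))) (by positivity : 0 ≤ (q * x 1) ^ 4)
      exact this.trans_eq (by field_simp)

end RealTensor

theorem theorem3p3 (A : RealTensor 4 2) (hA : A.IsSymmetric)
    (a1111 a1112 a1122 a1222 a2222 : ℝ)
    (h1111 : a1111 = A ![0, 0, 0, 0]) (h1112 : a1112 = A ![0, 0, 0, 1])
    (h1122 : a1122 = A ![0, 0, 1, 1]) (h1222 : a1222 = A ![0, 1, 1, 1])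
    (h2222 : a2222 = A ![1, 1, 1, 1])
    (hne1 : a1111 ≠ 0) (hne2 : a2222 ≠ 0) :
    A.IsCopositive ↔
      0 < a1111 ∧ 0 < a2222 ∧
      ((A.invI ^ 3 - 27 * A.invJ ^ 2 ≤ 0 ∧
          0 < a1222 * √a1111 + a1112 * √a2222) ∨
       (0 ≤ a1222 ∧ 0 ≤ a1112 ∧ 0 ≤ 3 * a1122 + √(a1111 * a2222)) ∨
       (0 ≤ A.invI ^ 3 - 27 * A.invJ ^ 2 ∧
          |a1112 * √a2222 - a1222 * √a1111| ≤
            √(6 * a1111 * a1122 * a2222 + 2 * a1111 * a2222 * √(a1111 * a2222)) ∧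
          ((-√(a1111 * a2222) ≤ 3 * a1122 ∧ 3 * a1122 ≤ 3 * √(a1111 * a2222)) ∨
           (√(a1111 * a2222) < a1122 ∧
              -√(6 * a1111 * a1122 * a2222 - 2 * a1111 * a2222 * √(a1111 * a2222)) ≤
                a1112 * √a2222 + a1222 * √a1111)))) := by
  by_cases hpos : 0 < a1111 ∧ 0 < a2222
  swap
  · refine iff_of_false (fun h => hpos ?_) (fun h => hpos ⟨h.1, h.2.1⟩)
    have h1 := h ![1, 0] (by intro k; fin_cases k <;> simp)
    have h2 := h ![0, 1] (by intro k; fin_cases k <;> simp)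
    rw [hA.form_four_two] at h1 h2
    simp [← h1111, ← h2222] at h1 h2
    exact ⟨lt_of_le_of_ne h1 hne1.symm, lt_of_le_of_ne h2 hne2.symm⟩
  obtain ⟨h1, h2⟩ := hpos
  -- With fourth roots `p`, `q`, the square roots of `a1111`, `a2222` and their product become
  -- monomials, and each condition is its normalized form times a positive monomial in `p`, `q`.
  obtain ⟨p, hp, hp4⟩ : ∃ p : ℝ, 0 < p ∧ a1111 = p ^ 4 := by
    refine ⟨√√a1111, by positivity, ?_⟩
    rw [show 4 = 2 * 2 from rfl, pow_mul, Real.sq_sqrt (by positivity), Real.sq_sqrt h1.le]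
  obtain ⟨q, hq, hq4⟩ : ∃ q : ℝ, 0 < q ∧ a2222 = q ^ 4 := by
    refine ⟨√√a2222, by positivity, ?_⟩
    rw [show 4 = 2 * 2 from rfl, pow_mul, Real.sq_sqrt (by positivity), Real.sq_sqrt h2.le]
  obtain ⟨α, hα⟩ : ∃ α, a1112 = α * (p ^ 3 * q) := ⟨a1112 / (p ^ 3 * q), by field_simp⟩
  obtain ⟨β, hβ⟩ : ∃ β, a1122 = β * (p ^ 2 * q ^ 2) := ⟨a1122 / (p ^ 2 * q ^ 2), by field_simp⟩
  obtain ⟨γ, hγ⟩ : ∃ γ, a1222 = γ * (p * q ^ 3) := ⟨a1222 / (p * q ^ 3), by field_simp⟩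
  have hΔ : A.invI ^ 3 - 27 * A.invJ ^ 2 = quarticDiscr α β γ * (p * q) ^ 12 := by
    unfold RealTensor.invI RealTensor.invJ quarticDiscr
    rw [← h1111, ← h1112, ← h1122, ← h1222, ← h2222, hp4, hα, hβ, hγ, hq4]
    ring
  rw [RealTensor.isCopositive_iff_forall_quartic (α := α) (β := β) (γ := γ) hA hp hq
    (by rw [← h1111, hp4]) (by rw [← h1112, hα]) (by rw [← h1122, hβ]) (by rw [← h1222, hγ])
    (by rw [← h2222, hq4]), forall_quartic_nonneg_iff, hΔ]
  have hsp : √(p ^ 4) = p ^ 2 := by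
    rw [show p ^ 4 = (p ^ 2) ^ 2 by ring, Real.sqrt_sq (by positivity)]
  have hsq : √(q ^ 4) = q ^ 2 := by
    rw [show q ^ 4 = (q ^ 2) ^ 2 by ring, Real.sqrt_sq (by positivity)]
  have hspq : √(p ^ 4 * q ^ 4) = p ^ 2 * q ^ 2 := by
    rw [show p ^ 4 * q ^ 4 = (p ^ 2 * q ^ 2) ^ 2 by ring, Real.sqrt_sq (by positivity)]
  have hscale : ∀ r : ℝ, √(r * ((p * q) ^ 3) ^ 2) = √r * (p * q) ^ 3 := fun r => by
    rw [Real.sqrt_mul' _ (by positivity), Real.sqrt_sq (by positivity)]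
  have h12 : 0 < (p * q) ^ 12 := by positivity
  have h3 : 0 < (p * q) ^ 3 := by positivity
  have h22 : 0 < p ^ 2 * q ^ 2 := by positivity
  have hpq1 : 0 < p ^ 3 * q := by positivity
  have hpq2 : 0 < p * q ^ 3 := by positivity
  subst hp4 hq4 hα hβ hγ
  rw [hsp, hsq, hspq]
  have e1 : γ * (p * q ^ 3) * p ^ 2 + α * (p ^ 3 * q) * q ^ 2 = (α + γ) * (p * q) ^ 3 := by ring
  have e1' : α * (p ^ 3 * q) * q ^ 2 + γ * (p * q ^ 3) * p ^ 2 = (α + γ) * (p * q) ^ 3 := by ring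
  have e2 : α * (p ^ 3 * q) * q ^ 2 - γ * (p * q ^ 3) * p ^ 2 = (α - γ) * (p * q) ^ 3 := by ring
  have e3 : 6 * p ^ 4 * (β * (p ^ 2 * q ^ 2)) * q ^ 4 + 2 * p ^ 4 * q ^ 4 * (p ^ 2 * q ^ 2) =
      (6 * β + 2) * ((p * q) ^ 3) ^ 2 := by ring
  have e4 : 6 * p ^ 4 * (β * (p ^ 2 * q ^ 2)) * q ^ 4 - 2 * p ^ 4 * q ^ 4 * (p ^ 2 * q ^ 2) =
      (6 * β - 2) * ((p * q) ^ 3) ^ 2 := by ring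
  have e5 : 3 * (β * (p ^ 2 * q ^ 2)) + p ^ 2 * q ^ 2 = (3 * β + 1) * (p ^ 2 * q ^ 2) := by ring
  have e6 : -(p ^ 2 * q ^ 2) ≤ 3 * (β * (p ^ 2 * q ^ 2)) ↔ -1 ≤ 3 * β := by
    rw [← mul_le_mul_iff_left₀ h22 (b := -1)]
    constructor <;> intro h <;> linarith
  have e7 : 3 * (β * (p ^ 2 * q ^ 2)) ≤ 3 * (p ^ 2 * q ^ 2) ↔ β ≤ 1 := by
    rw [← mul_le_mul_iff_left₀ h22 (b := β)]
    constructor <;> intro h <;> linarith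
  have e8 : p ^ 2 * q ^ 2 < β * (p ^ 2 * q ^ 2) ↔ 1 < β := lt_mul_iff_one_lt_left h22
  have e9 : quarticDiscr α β γ * (p * q) ^ 12 ≤ 0 ↔ quarticDiscr α β γ ≤ 0 :=
    ⟨fun h => nonpos_of_mul_nonpos_left h h12, fun h => mul_nonpos_of_nonpos_of_nonneg h h12.le⟩
  rw [e1, e1', e2, e3, e4, e5, e6, e7, e8, hscale, hscale, abs_mul, abs_of_pos h3, ← neg_mul,
    mul_le_mul_iff_left₀ h3, mul_le_mul_iff_left₀ h3, mul_nonneg_iff_of_pos_right h12,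
    mul_nonneg_iff_of_pos_right h22, mul_nonneg_iff_of_pos_right hpq1,
    mul_nonneg_iff_of_pos_right hpq2, mul_pos_iff_of_pos_right h3, e9]
  exact ⟨fun h => ⟨h1, h2, h⟩, fun h => h.2.2⟩
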